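/- Let $Y\subset\mathbb R^m$ be a closed unbounded set, $U_0$ a compact metric space, $U(\cdot):Y\leadsto U_0$ an upper semicontinuous compact-valued mapping, and let $f:\mathbb R^m\times U_0\to\mathbb R^m$ and $g:\mathbb R^m\times U_0\to\mathbb R$ be continuous. Put $$G:=\{(y,u)\,|\,y\in Y,\ u\in U(y),\ f(y,u)\in Y\}$$ and assume that $|f(y,u)|\to\infty$ as $|y|\to\infty$, $(y,u)\in G$, uniformly in $u$. An admissible process is a pair of sequences $(y(t),u(t))_{t\ge 0}$ with $y(t+1)=f(y(t),u(t))$, $y(t)\in Y$ and $u(t)\in U(y(t))$ for all $t\ge 0$. For a positive integer $S$, a process admissible on $\{0,\dots,S-1\}$ consists of $u(0),\dots,u(S-1)$ and $y(0),\dots,y(S)$ with $y(t+1)=f(y(t),u(t))$ and $u(t)\in U(y(t))$ for $t<S$, and $y(t)\in Y$ for $t\le S$. Assume that the system is viable, that is, from every $y_0\in Y$ starts an admissible process. For $y_0\in Y$, $\alpha\in(0,1)$ and integers $S\ge1$ let $$V_\alpha(y_0):=(1-\alpha)\inf\sum_{t=0}^\infty\alpha^t g(y(t),u(t)),\qquad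 V(S,y_0):=\frac1S\inf\sum_{t=0}^{S-1}g(y(t),u(t)),$$ where the infima are over the admissible processes, respectively the processes admissible on $\{0,\dots,S-1\}$, with $y(0)=y_0$. Let $\bar Y=Y\cup\{\infty\}$ be the one-point compactification of $Y$, $\mathcal P(G)$ the set of Borel probability measures on $G$, and $$W:=\Big\{\gamma\in\mathcal P(G)\ \Big|\ \int_G\big(\varphi(f(y,u))-\varphi(y)\big)\,d\gamma=0\ \text{ for all }\varphi\in C(\bar Y)\Big\},\qquad g^*:=\inf_{\gamma\in W}\int_G g\,d\gamma$$ (with $\inf\emptyset=+\infty$). Assume that $g$ is bounded on $G$ and that the following holds. (A1) There is a bounded set $D\subset G$ such that, for every $\alpha\in(0,1)$, the minimum of $\sum_{t=0}^\infty\alpha^t g(y(t),u(t))$ over all admissible processes (with arbitrary $y(0)\in Y$) is attained at a process with $(y(t),u(t))\in D$ for all $t\ge 0$, and, for every integer $S\ge1$, the minimum of $\sum_{t=0}^{S-1}g(y(t),u(t))$ over all processes admissible on $\{0,\dots,S-1\}$ (with arbitrary $y(0)\in Y$) is attained at a process with $(y(t),u(t))\in D$ for all $t<S$. Then the minima $\min_{y\in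 Y}V_\alpha(y)$ and $\min_{y\in Y}V(S,y)$ are attained for all $\alpha\in(0,1)$ and all $S\ge1$, and (a) $\displaystyle g^*\le\liminf_{\alpha\to1^-}\ \min_{y\in Y}V_\alpha(y)$; (b) $\displaystyle g^*\le\liminf_{S\to\infty}\ \min_{y\in Y}V(S,y)$. -/

import Mathlib

open Filter Topology MeasureTheory

noncomputable section

namespace ControlSys

/-- The state space `ℝ^m` with its Euclidean norm. -/
abbrev E (m : ℕ) : Type := EuclideanSpace ℝ (Fin m)

variable {m : ℕ} {U₀ : Type*}

/-- The set `G` of pairs `(y, u)` with `y ∈ Y`, `u ∈ U(y)` and `f(y, u) ∈ Y`. -/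
def G (Y : Set (E m)) (U : E m → Set U₀) (f : E m → U₀ → E m) : Set (E m × U₀) :=
  {p | p.1 ∈ Y ∧ p.2 ∈ U p.1 ∧ f p.1 p.2 ∈ Y}

/-- `(y(·), u(·))` is an admissible process on the infinite time horizon. -/
structure Admissible (Y : Set (E m)) (U : E m → Set U₀) (f : E m → U₀ → E m)
    (y : ℕ → E m) (u : ℕ → U₀) : Prop where
  step : ∀ t, y (t + 1) = f (y t) (u t)
  state_mem : ∀ t, y t ∈ Y
  control_mem : ∀ t, u t ∈ U (y t)

/-- `(y(·), u(·))` is an admissible process on the time sequence `0, …, S - 1`. The controls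
`u 0, …, u (S - 1)` produce the states `y 0, …, y S`, all of which have to lie in `Y`, so that
`(y t, u t) ∈ G` for all `t < S`. Values of `u` at times `t ≥ S` and of `y` at times `t > S` are
irrelevant. -/
structure AdmissibleUpTo (Y : Set (E m)) (U : E m → Set U₀) (f : E m → U₀ → E m) (S : ℕ)
    (y : ℕ → E m) (u : ℕ → U₀) : Prop where
  step : ∀ t < S, y (t + 1) = f (y t) (u t)
  state_mem : ∀ t ≤ S, y t ∈ Y
  control_mem : ∀ t < S, u t ∈ U (y t)

/-- The system is viable on `Y`: from every initial state in `Y` starts an admissible process. -/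
def Viable (Y : Set (E m)) (U : E m → Set U₀) (f : E m → U₀ → E m) : Prop :=
  ∀ y₀ ∈ Y, ∃ y u, Admissible Y U f y u ∧ y 0 = y₀

/-- The discounted cost `∑_{t ≥ 0} α^t g(y(t), u(t))`. It is used only for `0 < α < 1` and `g`
bounded along the process, when the series converges absolutely. -/
def discountedCost (g : E m → U₀ → ℝ) (α : ℝ) (y : ℕ → E m) (u : ℕ → U₀) : ℝ :=
  ∑' t, α ^ t * g (y t) (u t)

/-- The total cost `∑_{t < S} g(y(t), u(t))`. -/
def totalCost (g : E m → U₀ → ℝ) (S : ℕ) (y : ℕ → E m) (u : ℕ → U₀) : ℝ :=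
  ∑ t ∈ Finset.range S, g (y t) (u t)

/-- The value `V_α(y₀)`: the infimum of `(1 - α) ∑_{t ≥ 0} α^t g(y(t), u(t))` over all admissible
processes that start at `y₀`. -/
def Vdisc (Y : Set (E m)) (U : E m → Set U₀) (f : E m → U₀ → E m) (g : E m → U₀ → ℝ)
    (α : ℝ) (y₀ : E m) : EReal :=
  ⨅ (y : ℕ → E m) (u : ℕ → U₀) (_ : Admissible Y U f y u ∧ y 0 = y₀),
    (((1 - α) * discountedCost g α y u : ℝ) : EReal)

/-- The value `V(S, y₀)`: the infimum of `(1/S) ∑_{t < S} g(y(t), u(t))` over all processes that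
are admissible on `0, …, S - 1` and start at `y₀`. -/
def Vavg (Y : Set (E m)) (U : E m → Set U₀) (f : E m → U₀ → E m) (g : E m → U₀ → ℝ)
    (S : ℕ) (y₀ : E m) : EReal :=
  ⨅ (y : ℕ → E m) (u : ℕ → U₀) (_ : AdmissibleUpTo Y U f S y u ∧ y 0 = y₀),
    ((1 / (S : ℝ) * totalCost g S y u : ℝ) : EReal)

/-- The set `W` of the Borel probability measures `γ` on `G` with
`∫_G (φ(f(y, u)) - φ(y)) dγ = 0` for all `φ` in `C(Ȳ)`, where `Ȳ = Y ∪ {∞}` is the one-point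
compactification of `Y`. -/
def W [TopologicalSpace U₀] [MeasurableSpace U₀]
    (Y : Set (E m)) (U : E m → Set U₀) (f : E m → U₀ → E m) :
    Set (ProbabilityMeasure (G Y U f)) :=
  {γ | ∀ φ : C(OnePoint Y, ℝ),
    ∫ p : G Y U f, (φ ((⟨f p.1.1 p.1.2, p.2.2.2⟩ : Y) : OnePoint Y)
      - φ ((⟨p.1.1, p.2.1⟩ : Y) : OnePoint Y)) ∂(γ : Measure (G Y U f)) = 0}

/-- `g* = inf_{γ ∈ W} ∫_G g dγ`, which is `+∞` if `W` is empty. -/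
def gStar [TopologicalSpace U₀] [MeasurableSpace U₀]
    (Y : Set (E m)) (U : E m → Set U₀) (f : E m → U₀ → E m) (g : E m → U₀ → ℝ) : EReal :=
  ⨅ γ ∈ W Y U f, ((∫ p : G Y U f, g p.1.1 p.1.2 ∂(γ : Measure (G Y U f)) : ℝ) : EReal)

/-- For every discount factor and every horizon there is an optimal process, where the minimization
is over the control and the initial condition, that remains in `D`; the set `D ⊆ G` is bounded
and does not depend on the discount factor or on the horizon. -/
def BoundedOptimalProcesses [PseudoMetricSpace U₀]
    (Y : Set (E m)) (U : E m → Set U₀) (f : E m → U₀ → E m) (g : E m → U₀ → ℝ) : Prop :=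
  ∃ D ⊆ G Y U f, Bornology.IsBounded D ∧
    (∀ α ∈ Set.Ioo (0 : ℝ) 1, ∃ y u, Admissible Y U f y u ∧ (∀ t, (y t, u t) ∈ D) ∧
      ∀ y' u', Admissible Y U f y' u' → discountedCost g α y u ≤ discountedCost g α y' u') ∧
    (∀ S : ℕ, 1 ≤ S → ∃ y u, AdmissibleUpTo Y U f S y u ∧ (∀ t < S, (y t, u t) ∈ D) ∧
      ∀ y' u', AdmissibleUpTo Y U f S y' u' → totalCost g S y u ≤ totalCost g S y' u')

end ControlSys

end

/-! The proof passes to weak limits of occupational measures. By (A1) the optimal processes stay in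
`D`. Since `D` is bounded and `G` is closed (`isClosed_G`), `closure D` is a compact subset of `G`,
so no mass can escape to infinity.

The occupational measure of an optimal process integrates `g` to the normalised optimal cost, a
lower bound for the value at every initial state. Its integral of an increment `φ(f(y, u)) - φ(y)`
telescopes to at most `2(1 - α)‖φ‖`, respectively `(2 / S)‖φ‖` (`exists_discounted_occupational`,
`exists_average_occupational`). A weak limit therefore annihilates all increments and, pushed
forward to `G`, lies in `W`; this gives both bounds at once (`gStar_le_liminf`). The minima are
attained at the initial states of the optimal processes. -/

namespace ControlSys

section Measures

variable {X : Type*} [TopologicalSpace X] [MeasurableSpace X] [BorelSpace X]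

/-- The discrete probability measure with weights `w t` at the points `p t`, described by the
integrals of continuous functions. -/
lemma exists_probabilityMeasure_hasSum [CompactSpace X] (p : ℕ → X) (w : ℕ → ℝ)
    (hw : ∀ t, 0 ≤ w t) (hsum : HasSum w 1) :
    ∃ μ : ProbabilityMeasure X, ∀ h : X → ℝ, Continuous h →
      HasSum (fun t => w t * h (p t)) (∫ x, h x ∂(μ : Measure X)) := by
  set ν : ℕ → Measure X := fun t => ENNReal.ofReal (w t) • Measure.dirac (p t)
  have hprob : IsProbabilityMeasure (Measure.sum ν) := ⟨by
    simp [ν, Measure.sum_apply, ← ENNReal.ofReal_tsum_of_nonneg hw hsum.summable, hsum.tsum_eq]⟩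
  refine ⟨⟨Measure.sum ν, hprob⟩, fun h hh => ?_⟩
  have hint : Integrable h (Measure.sum ν) :=
    hh.integrable_of_hasCompactSupport (HasCompactSupport.of_compactSpace h)
  have hm : StronglyMeasurable h := hh.stronglyMeasurable_of_hasCompactSupport
    (HasCompactSupport.of_compactSpace h)
  have hterm : ∀ t, ∫ x, h x ∂(ν t) = w t * h (p t) := fun t => by
    simp [ν, integral_smul_measure, integral_dirac' h (p t) hm, ENNReal.toReal_ofReal (hw t)]
  have key := hasSum_integral_measure hint
  simp only [hterm] at key
  exact key

end Measures

section Sums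

/-- The discounted mean of the increments of a bounded sequence. -/
lemma abs_discounted_increments_le {a : ℕ → ℝ} {M α : ℝ} (hα : α ∈ Set.Ioo (0 : ℝ) 1)
    (ha : ∀ t, |a t| ≤ M) {I : ℝ}
    (hI : HasSum (fun t => (1 - α) * α ^ t * (a (t + 1) - a t)) I) :
    |I| ≤ 2 * (1 - α) * M := by
  obtain ⟨h0, h1⟩ := hα
  have hgeo : HasSum (fun t => α ^ t * M) ((1 - α)⁻¹ * M) :=
    (hasSum_geometric_of_lt_one h0.le h1).mul_right M
  have hbd : ∀ t, ‖α ^ t * a (t + 1)‖ ≤ α ^ t * M := fun t => by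
    rw [norm_mul, Real.norm_of_nonneg (by positivity)]
    exact mul_le_mul_of_nonneg_left (ha _) (by positivity)
  have hs1 : Summable (fun t => α ^ t * a (t + 1)) := .of_norm_bounded hgeo.summable hbd
  have hs0 : Summable (fun t => α ^ t * a t) := .of_norm_bounded hgeo.summable fun t => by
    rw [norm_mul, Real.norm_of_nonneg (by positivity)]
    exact mul_le_mul_of_nonneg_left (ha _) (by positivity)
  have hB : ‖∑' t, α ^ t * a (t + 1)‖ ≤ (1 - α)⁻¹ * M := tsum_of_norm_bounded hgeo hbd
  set B := ∑' t, α ^ t * a (t + 1) with hBdef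
  -- Abel summation: the unshifted sum is `a 0 + α B`, so its difference from `B` is `(1 - α) B - a
  -- 0`, bounded by `2 M` because `|B| ≤ M / (1 - α)`.
  have hA : ∑' t, α ^ t * a t = a 0 + α * B := by
    rw [hs0.tsum_eq_zero_add, hBdef, ← tsum_mul_left]
    simp [pow_succ', mul_assoc]
  have hIeq : I = (1 - α) * (B - (a 0 + α * B)) := by
    rw [← hA, hBdef, ← hs1.tsum_sub hs0, ← tsum_mul_left, ← hI.tsum_eq]
    exact tsum_congr fun t => by ring
  have hB' : (1 - α) * |B| ≤ M := by
    have := mul_le_mul_of_nonneg_left hB (sub_nonneg.2 h1.le)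
    rwa [← mul_assoc, mul_inv_cancel₀ (sub_pos.2 h1).ne', one_mul] at this
  have : I = (1 - α) * ((1 - α) * B - a 0) := by rw [hIeq]; ring
  rw [this, abs_mul, abs_of_pos (sub_pos.2 h1)]
  have : |(1 - α) * B - a 0| ≤ 2 * M := by
    have h2 := abs_sub ((1 - α) * B) (a 0)
    rw [abs_mul, abs_of_pos (sub_pos.2 h1)] at h2
    linarith [ha 0]
  nlinarith [sub_pos.2 h1]

/-- Writes a finite average as a series with weights vanishing from `S` on, so that both kinds of
occupational measure come from the same construction. -/
lemma hasSum_ite_range (S : ℕ) (c : ℝ) (a : ℕ → ℝ) :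
    HasSum (fun t => (if t < S then c else 0) * a t) (c * ∑ t ∈ Finset.range S, a t) := by
  rw [Finset.mul_sum]
  have key : HasSum (fun t => (if t < S then c else 0) * a t)
      (∑ t ∈ Finset.range S, (if t < S then c else 0) * a t) :=
    hasSum_sum_of_ne_finset_zero fun t ht => by simp_all
  convert key using 1
  exact Finset.sum_congr rfl fun t ht => by rw [if_pos (Finset.mem_range.1 ht)]

end Sums

variable {m : ℕ} {U₀ : Type*}

/-! ### The graph `G` and increments of test functions -/

/-- If the control of a limit point `p` were outside the compact set `U p.1`, some closed
neighbourhood `V` of it would miss that set. Upper semicontinuity keeps `U q.1` off `V` for `q` in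
`G` near `p`, whereas `q.2` lies in `V`. -/
lemma isClosed_G [TopologicalSpace U₀] [T3Space U₀]
    {Y : Set (E m)} {U : E m → Set U₀} {f : E m → U₀ → E m}
    (hY : IsClosed Y) (hU : UpperHemicontinuousOn U Y) (hUc : ∀ y ∈ Y, IsCompact (U y))
    (hf : Continuous (fun p : E m × U₀ => f p.1 p.2)) : IsClosed (G Y U f) := by
  refine isClosed_of_closure_subset fun p hp => ?_
  have hp1 : p.1 ∈ Y := closure_minimal (fun q hq => hq.1) (hY.preimage continuous_fst) hp
  have hpf : f p.1 p.2 ∈ Y := closure_minimal (fun q hq => hq.2.2) (hY.preimage hf) hp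
  refine ⟨hp1, ?_, hpf⟩
  by_contra hnot
  obtain ⟨V, hV, hVc, hVU⟩ := exists_mem_nhds_isClosed_subset
    ((hUc _ hp1).isClosed.isOpen_compl.mem_nhds hnot)
  have hVn : Vᶜ ∈ 𝓝ˢ (U p.1) :=
    hVc.isOpen_compl.mem_nhdsSet.2 fun x hx hxV => hVU hxV hx
  have hev := eventually_nhdsWithin_iff.1
    (upperHemicontinuousWithinAt_iff.1 (hU.upperHemicontinuousWithinAt hp1) _ hVn)
  have hev' : ∀ᶠ q : E m × U₀ in 𝓝 p, (q.1 ∈ Y → Vᶜ ∈ 𝓝ˢ (U q.1)) ∧ q.2 ∈ V :=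
    (continuous_fst.continuousAt.eventually hev).and (continuous_snd.continuousAt.eventually hV)
  obtain ⟨q, hqG, hq, hqV⟩ := ((mem_closure_iff_frequently.1 hp).and_eventually hev').exists
  exact subset_of_mem_nhdsSet (hq hqG.1) hqG.2.1 hqV

/-- The increment `φ(f(y, u)) - φ(y)` of `φ` along the system. -/
def increment {Y : Set (E m)} {U : E m → Set U₀} {f : E m → U₀ → E m}
    (φ : C(OnePoint Y, ℝ)) (p : G Y U f) : ℝ :=
  φ ((⟨f p.1.1 p.1.2, p.2.2.2⟩ : Y) : OnePoint Y) - φ ((⟨p.1.1, p.2.1⟩ : Y) : OnePoint Y)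

lemma continuous_increment [TopologicalSpace U₀]
    {Y : Set (E m)} {U : E m → Set U₀} {f : E m → U₀ → E m}
    (hf : Continuous (fun p : E m × U₀ => f p.1 p.2)) (φ : C(OnePoint Y, ℝ)) :
    Continuous (increment φ : G Y U f → ℝ) := by
  refine (φ.continuous.comp (OnePoint.continuous_coe.comp ?_)).sub
    (φ.continuous.comp (OnePoint.continuous_coe.comp ?_))
  · exact (hf.comp continuous_subtype_val).subtype_mk _
  · exact (continuous_fst.comp continuous_subtype_val).subtype_mk _

/-! ### Weak limits of asymptotically invariant measures -/

section Limit

variable [MetricSpace U₀] [CompactSpace U₀] [MeasurableSpace U₀] [BorelSpace U₀]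

/-- If the values `v i` dominate the integrals of `g` with respect to probability measures on a
fixed compact subset of `G` which asymptotically satisfy the equations that define `W`, then `g*`
is at most the lower limit of `v`. -/
lemma gStar_le_liminf {Y : Set (E m)} {U : E m → Set U₀} {f : E m → U₀ → E m} {g : E m → U₀ → ℝ}
    (hf : Continuous (fun p : E m × U₀ => f p.1 p.2))
    (hg : Continuous (fun p : E m × U₀ => g p.1 p.2))
    {K : Set (E m × U₀)} (hK : IsCompact K) (hKG : K ⊆ G Y U f)
    {ι : Type*} {l : Filter ι} {v : ι → EReal} {ε : ι → ℝ} (hε : Tendsto ε l (𝓝 0))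
    (hμ : ∀ᶠ i in l, ∃ μ : ProbabilityMeasure K,
      ((∫ p : K, g p.1.1 p.1.2 ∂(μ : Measure K) : ℝ) : EReal) ≤ v i ∧
      ∀ φ : C(OnePoint Y, ℝ),
        |∫ p : K, increment φ (Set.inclusion hKG p) ∂(μ : Measure K)| ≤ ε i * ‖φ‖) :
    gStar Y U f g ≤ liminf v l := by
  by_contra hlt
  obtain ⟨c, hc1, hc2⟩ := exists_between (not_le.1 hlt)
  have hfreq : ∃ᶠ i in l, v i < c := frequently_lt_of_liminf_lt (by isBoundedDefault) hc1
  obtain ⟨μ, hμ⟩ : ∃ μ : ι → ProbabilityMeasure K, ∀ᶠ i in l,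
      ((∫ p : K, g p.1.1 p.1.2 ∂(μ i : Measure K) : ℝ) : EReal) ≤ v i ∧
      ∀ φ : C(OnePoint Y, ℝ),
        |∫ p : K, increment φ (Set.inclusion hKG p) ∂(μ i : Measure K)| ≤ ε i * ‖φ‖ := by
    have : l.NeBot := ⟨fun h => by simp [h] at hfreq⟩
    obtain ⟨i, _, ⟨μ₀, _⟩⟩ := (hfreq.and_eventually hμ).exists
    have : Nonempty (ProbabilityMeasure K) := ⟨μ₀⟩
    exact hμ.choice
  have : NeBot (l ⊓ 𝓟 {i | v i < c}) := frequently_mem_iff_neBot.1 hfreq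
  -- An ultrafilter replaces the choice of a convergent subsequence and works for any `l`; refining
  -- by `v i < c` forces the limit to satisfy `∫ g ≤ c`, against `c < g*`.
  set F : Ultrafilter ι := Ultrafilter.of (l ⊓ 𝓟 {i | v i < c})
  have hF : (F : Filter ι) ≤ l ⊓ 𝓟 {i | v i < c} := Ultrafilter.of_le _
  have hFl : (F : Filter ι) ≤ l := hF.trans inf_le_left
  have hFv : ∀ᶠ i in (F : Filter ι), v i < c := hF.trans inf_le_right (mem_principal_self _)
  have : CompactSpace K := isCompact_iff_compactSpace.1 hK
  obtain ⟨γ, -, hγ⟩ := (isCompact_univ (X := ProbabilityMeasure K)).ultrafilter_le_nhds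
    (F.map μ) (by simp)
  have hlim : ∀ h : K → ℝ, Continuous h →
      Tendsto (fun i => ∫ x, h x ∂(μ i : Measure K)) F (𝓝 (∫ x, h x ∂(γ : Measure K))) :=
    fun h hh => ProbabilityMeasure.tendsto_iff_forall_integral_tendsto.1
      (show Tendsto μ F (𝓝 γ) from hγ) (BoundedContinuousFunction.mkOfCompact ⟨h, hh⟩)
  have hincl : Continuous (Set.inclusion hKG) := continuous_inclusion hKG
  have hgc : Continuous (fun p : G Y U f => g p.1.1 p.1.2) := hg.comp continuous_subtype_val
  have hmap : ∀ h : G Y U f → ℝ, Continuous h →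
      ∫ p, h p ∂(γ.map hincl.measurable.aemeasurable : Measure (G Y U f))
        = ∫ p : K, h (Set.inclusion hKG p) ∂(γ : Measure K) := fun h hh =>
    integral_map hincl.measurable.aemeasurable hh.aestronglyMeasurable
  have hW : γ.map hincl.measurable.aemeasurable ∈ W Y U f := fun φ => by
    refine (hmap _ (continuous_increment hf φ)).trans ?_
    refine tendsto_nhds_unique (hlim _ ((continuous_increment hf φ).comp hincl)) ?_
    refine squeeze_zero_norm' (hFl (hμ.mono fun i hi => hi.2 φ)) ?_
    simpa using (hε.mono_left hFl).mul_const ‖φ‖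
  have hgle : gStar Y U f g ≤
      ((∫ p : K, g p.1.1 p.1.2 ∂(γ : Measure K) : ℝ) : EReal) := by
    refine (iInf₂_le _ hW).trans (le_of_eq ?_)
    rw [hmap _ hgc]
  refine absurd (hgle.trans (le_of_tendsto (continuous_coe_real_ereal.continuousAt.tendsto.comp
    (hlim _ (hgc.comp hincl))) ?_)) (not_le.2 hc2)
  filter_upwards [hFl hμ, hFv] with i hi hvi
  exact hi.1.trans hvi.le

end Limit

section Values

variable {Y : Set (E m)} {U : E m → Set U₀} {f : E m → U₀ → E m} {g : E m → U₀ → ℝ}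

lemma Vdisc_le {α : ℝ} {y : ℕ → E m} {u : ℕ → U₀} (h : Admissible Y U f y u) :
    Vdisc Y U f g α (y 0) ≤ (((1 - α) * discountedCost g α y u : ℝ) : EReal) :=
  iInf_le_of_le y (iInf_le_of_le u (iInf_le _ ⟨h, rfl⟩))

lemma le_Vdisc {α : ℝ} (hα : α ≤ 1) {y : ℕ → E m} {u : ℕ → U₀}
    (hmin : ∀ y' u', Admissible Y U f y' u' → discountedCost g α y u ≤ discountedCost g α y' u')
    (y₀ : E m) : (((1 - α) * discountedCost g α y u : ℝ) : EReal) ≤ Vdisc Y U f g α y₀ :=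
  le_iInf fun y' => le_iInf fun u' => le_iInf fun h => EReal.coe_le_coe_iff.2
    (mul_le_mul_of_nonneg_left (hmin y' u' h.1) (sub_nonneg.2 hα))

lemma Vavg_le {S : ℕ} {y : ℕ → E m} {u : ℕ → U₀} (h : AdmissibleUpTo Y U f S y u) :
    Vavg Y U f g S (y 0) ≤ ((1 / (S : ℝ) * totalCost g S y u : ℝ) : EReal) :=
  iInf_le_of_le y (iInf_le_of_le u (iInf_le _ ⟨h, rfl⟩))

lemma le_Vavg {S : ℕ} {y : ℕ → E m} {u : ℕ → U₀}
    (hmin : ∀ y' u', AdmissibleUpTo Y U f S y' u' → totalCost g S y u ≤ totalCost g S y' u')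
    (y₀ : E m) : ((1 / (S : ℝ) * totalCost g S y u : ℝ) : EReal) ≤ Vavg Y U f g S y₀ :=
  le_iInf fun y' => le_iInf fun u' => le_iInf fun h => EReal.coe_le_coe_iff.2
    (mul_le_mul_of_nonneg_left (hmin y' u' h.1) (by positivity))

end Values

/-! ### Occupational measures of processes -/

section Occupational

variable [MetricSpace U₀] [CompactSpace U₀] [MeasurableSpace U₀] [BorelSpace U₀]
  {Y : Set (E m)} {U : E m → Set U₀} {f : E m → U₀ → E m} {g : E m → U₀ → ℝ}
  {K : Set (E m × U₀)}

/-- The discounted occupational measure of an admissible process in `K`. -/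
lemma exists_discounted_occupational (hf : Continuous (fun p : E m × U₀ => f p.1 p.2))
    (hg : Continuous (fun p : E m × U₀ => g p.1 p.2))
    (hK : IsCompact K) (hKG : K ⊆ G Y U f) {α : ℝ} (hα : α ∈ Set.Ioo (0 : ℝ) 1)
    {y : ℕ → E m} {u : ℕ → U₀} (h : Admissible Y U f y u) (hyu : ∀ t, (y t, u t) ∈ K) :
    ∃ μ : ProbabilityMeasure K,
      ∫ p : K, g p.1.1 p.1.2 ∂(μ : Measure K) = (1 - α) * discountedCost g α y u ∧
      ∀ φ : C(OnePoint Y, ℝ), |∫ p : K, increment φ (Set.inclusion hKG p) ∂(μ : Measure K)|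
        ≤ 2 * (1 - α) * ‖φ‖ := by
  have : CompactSpace K := isCompact_iff_compactSpace.1 hK
  have h1 : 0 < 1 - α := sub_pos.2 hα.2
  have hgK : Continuous (fun p : K => g p.1.1 p.1.2) := hg.comp continuous_subtype_val
  have hφK (φ : C(OnePoint Y, ℝ)) : Continuous (fun p : K => increment φ (Set.inclusion hKG p)) :=
    (continuous_increment hf φ).comp (continuous_inclusion hKG)
  obtain ⟨μ, hμ⟩ := exists_probabilityMeasure_hasSum (fun t => (⟨(y t, u t), hyu t⟩ : K))
    (fun t => (1 - α) * α ^ t) (fun t => mul_nonneg h1.le (pow_nonneg hα.1.le t))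
    (by simpa [h1.ne'] using (hasSum_geometric_of_lt_one hα.1.le hα.2).mul_left (1 - α))
  refine ⟨μ, ?_, fun φ => ?_⟩
  · rw [← (hμ _ hgK).tsum_eq, discountedCost, ← tsum_mul_left]
    exact tsum_congr fun t => mul_assoc _ _ _
  · refine abs_discounted_increments_le (a := fun t => φ ((⟨y t, h.state_mem t⟩ : Y) : OnePoint Y))
      hα (fun t => φ.norm_coe_le_norm _) ?_
    convert hμ _ (hφK φ) using 3 with t
    simp [increment, h.step t]

/-- The occupational measure of a process in `K` that is admissible on `0, …, S - 1`. -/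
lemma exists_average_occupational (hf : Continuous (fun p : E m × U₀ => f p.1 p.2))
    (hg : Continuous (fun p : E m × U₀ => g p.1 p.2))
    (hK : IsCompact K) (hKG : K ⊆ G Y U f) {S : ℕ} (hS : 1 ≤ S)
    {y : ℕ → E m} {u : ℕ → U₀} (h : AdmissibleUpTo Y U f S y u)
    (hyu : ∀ t < S, (y t, u t) ∈ K) :
    ∃ μ : ProbabilityMeasure K,
      ∫ p : K, g p.1.1 p.1.2 ∂(μ : Measure K) = 1 / (S : ℝ) * totalCost g S y u ∧
      ∀ φ : C(OnePoint Y, ℝ), |∫ p : K, increment φ (Set.inclusion hKG p) ∂(μ : Measure K)|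
        ≤ 2 * (1 / (S : ℝ)) * ‖φ‖ := by
  have : CompactSpace K := isCompact_iff_compactSpace.1 hK
  have hS0 : (S : ℝ) ≠ 0 := by positivity
  have hgK : Continuous (fun p : K => g p.1.1 p.1.2) := hg.comp continuous_subtype_val
  have hφK (φ : C(OnePoint Y, ℝ)) : Continuous (fun p : K => increment φ (Set.inclusion hKG p)) :=
    (continuous_increment hf φ).comp (continuous_inclusion hKG)
  -- Only times `t < S` are known to give points of `K`; the later default has weight zero.
  set q : ℕ → K := fun t => if ht : t < S then ⟨(y t, u t), hyu t ht⟩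
    else ⟨(y 0, u 0), hyu 0 hS⟩
  have hqt : ∀ t, ∀ ht : t < S, q t = ⟨(y t, u t), hyu t ht⟩ := fun t ht => dif_pos ht
  obtain ⟨μ, hμ⟩ := exists_probabilityMeasure_hasSum q
    (fun t => if t < S then 1 / (S : ℝ) else 0) (fun t => by positivity)
    (by simpa [hS0] using hasSum_ite_range S (1 / (S : ℝ)) fun _ => 1)
  have hint : ∀ k : K → ℝ, Continuous k → ∫ p, k p ∂(μ : Measure K)
      = 1 / (S : ℝ) * ∑ t ∈ Finset.range S, k (q t) := fun k hk =>
    (hμ k hk).unique (hasSum_ite_range S _ fun t => k (q t))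
  refine ⟨μ, ?_, fun φ => ?_⟩
  · rw [hint _ hgK, totalCost]
    congr 1
    exact Finset.sum_congr rfl fun t ht => by simp [hqt t (Finset.mem_range.1 ht)]
  · rw [hint _ (hφK φ)]
    -- The bound is `t ≤ S`, one step beyond `q`: the telescoped sum ends at `y S`, which lies in
    -- `Y` although no control is prescribed there.
    set a : ℕ → ℝ := fun t => if ht : t ≤ S then
      φ ((⟨y t, h.state_mem t ht⟩ : Y) : OnePoint Y) else 0 with ha
    have hat : ∀ t, |a t| ≤ ‖φ‖ := fun t => by
      by_cases ht : t ≤ S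
      · simpa [ha, ht] using φ.norm_coe_le_norm _
      · simp [ha, ht]
    have hsum : ∑ t ∈ Finset.range S, increment φ (Set.inclusion hKG (q t)) = a S - a 0 := by
      rw [← Finset.sum_range_sub]
      refine Finset.sum_congr rfl fun t ht => ?_
      have ht := Finset.mem_range.1 ht
      simp [hqt t ht, increment, ha, ht.le, Nat.succ_le_of_lt ht, h.step t ht]
    rw [hsum, abs_mul, abs_of_nonneg (by positivity), mul_comm 2, mul_assoc]
    refine mul_le_mul_of_nonneg_left ?_ (by positivity)
    linarith [abs_sub (a S) (a 0), hat S, hat 0]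

end Occupational

end ControlSys

theorem proposition5p3 {m : ℕ} {U₀ : Type*} [MetricSpace U₀] [CompactSpace U₀]
    [MeasurableSpace U₀] [BorelSpace U₀]
    (Y : Set (ControlSys.E m)) (U : ControlSys.E m → Set U₀)
    (f : ControlSys.E m → U₀ → ControlSys.E m) (g : ControlSys.E m → U₀ → ℝ)
    (hY_closed : IsClosed Y) (hY_unbounded : ¬ Bornology.IsBounded Y)
    (hU_usc : UpperHemicontinuousOn U Y) (hU_compact : ∀ y ∈ Y, IsCompact (U y))
    (hf : Continuous (fun p : ControlSys.E m × U₀ => f p.1 p.2))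
    (hf_infty : ∀ R : ℝ, ∃ r : ℝ, ∀ p ∈ ControlSys.G Y U f, r ≤ ‖p.1‖ → R ≤ ‖f p.1 p.2‖)
    (h_viable : ControlSys.Viable Y U f)
    (hg : Continuous (fun p : ControlSys.E m × U₀ => g p.1 p.2))
    (hg_bdd : ∃ C : ℝ, ∀ p ∈ ControlSys.G Y U f, |g p.1 p.2| ≤ C)
    (hA1 : ControlSys.BoundedOptimalProcesses Y U f g) :
    -- the minima over `y ∈ Y` are attained
    ((∀ α ∈ Set.Ioo (0 : ℝ) 1, ∃ y ∈ Y, IsMinOn (ControlSys.Vdisc Y U f g α) Y y) ∧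
      (∀ S : ℕ, 1 ≤ S → ∃ y ∈ Y, IsMinOn (ControlSys.Vavg Y U f g S) Y y)) ∧
    -- (a)
    ControlSys.gStar Y U f g ≤
      liminf (fun α : ℝ => ⨅ y ∈ Y, ControlSys.Vdisc Y U f g α y) (𝓝[<] 1) ∧
    -- (b)
    ControlSys.gStar Y U f g ≤
      liminf (fun S : ℕ => ⨅ y ∈ Y, ControlSys.Vavg Y U f g S y) atTop := by
  obtain ⟨D, hDG, hDb, hdisc, havg⟩ := hA1
  have hGc := ControlSys.isClosed_G hY_closed hU_usc hU_compact hf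
  have hK : IsCompact (closure D) := hDb.isCompact_closure
  have hKG : closure D ⊆ ControlSys.G Y U f := closure_minimal hDG hGc
  refine ⟨⟨fun α hα => ?_, fun S hS => ?_⟩, ?_, ?_⟩
  · obtain ⟨y, u, hadm, -, hmin⟩ := hdisc α hα
    exact ⟨y 0, hadm.state_mem 0,
      fun y₀ _ => (ControlSys.Vdisc_le hadm).trans (ControlSys.le_Vdisc hα.2.le hmin y₀)⟩
  · obtain ⟨y, u, hadm, -, hmin⟩ := havg S hS
    exact ⟨y 0, hadm.state_mem 0 (Nat.zero_le S),
      fun y₀ _ => (ControlSys.Vavg_le hadm).trans (ControlSys.le_Vavg hmin y₀)⟩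
  · have hε : Tendsto (fun α : ℝ => 2 * (1 - α)) (𝓝[<] 1) (𝓝 0) := by
      have : Continuous (fun α : ℝ => 2 * (1 - α)) := by fun_prop
      simpa using (this.tendsto 1).mono_left nhdsWithin_le_nhds
    refine ControlSys.gStar_le_liminf hf hg hK hKG hε ?_
    filter_upwards [Ioo_mem_nhdsLT (zero_lt_one' ℝ)] with α hα
    obtain ⟨y, u, hadm, hD, hmin⟩ := hdisc α hα
    obtain ⟨μ, hμg, hμ⟩ := ControlSys.exists_discounted_occupational hf hg hK hKG hα hadm
      fun t => subset_closure (hD t)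
    exact ⟨μ, hμg ▸ le_iInf₂ fun y₀ _ => ControlSys.le_Vdisc hα.2.le hmin y₀, hμ⟩
  · have hε : Tendsto (fun S : ℕ => 2 * (1 / (S : ℝ))) atTop (𝓝 0) := by
      simpa using tendsto_one_div_atTop_nhds_zero_nat.const_mul (2 : ℝ)
    refine ControlSys.gStar_le_liminf hf hg hK hKG hε ?_
    filter_upwards [eventually_ge_atTop 1] with S hS
    obtain ⟨y, u, hadm, hD, hmin⟩ := havg S hS
    obtain ⟨μ, hμg, hμ⟩ := ControlSys.exists_average_occupational hf hg hK hKG hS hadm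
      fun t ht => subset_closure (hD t ht)
    exact ⟨μ, hμg ▸ le_iInf₂ fun y₀ _ => ControlSys.le_Vavg hmin y₀, hμ⟩
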